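/- Let $d\ge 1$, let $f(\theta,\cdot):\mathbb{R}^d\to\mathbb{R}$ be a scalar field depending on a parameter $\theta$ (the case of surfaces is $d=3$), let $S_\theta=\{x\in\mathbb{R}^d : f(\theta,x)=0\}$, $g(\theta,x)=\nabla_x f(\theta,x)$, and let $\Omega\subset\mathbb{R}^d$ be a bounded measurable set. Write $\mathcal{H}^{d-1}$ for the $(d-1)$-dimensional surface measure (the Hausdorff measure, normalized to agree with Lebesgue measure on $\mathbb{R}^{d-1}$; for $d=3$, surface area). For $\alpha>0$ let $$L_{\mathrm{SSA}}^\alpha(\theta)=\frac{\alpha}{2}\int_\Omega e^{-\alpha|f(\theta,x)|}\,dx .$$ Fix $\theta$ and assume that $f(\theta,\cdot)$ is continuous on $\overline\Omega$; that at every point of $S_\theta\cap\overline\Omega$ the field $f(\theta,\cdot)$ is continuously differentiable in a neighbourhood of that point and $g(\theta,\cdot)\neq 0$ there; and that the part of the surface lying on the boundary of $\Omega$ is negligible, $\mathcal{H}^{d-1}(S_\theta\cap\partial\Omega)=0$ (for instance, $S_\theta\cap\partial\Omega=\emptyset$). Then the integrals below exist and are finite, and $$\lim_{\alpha\to\infty}L_{\mathrm{SSA}}^\alpha(\theta)=\int_{S_\theta\cap\Omega}\frac{1}{\|g(\theta,x)\|}\,d\mathcal{H}^{d-1}(x).$$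 If, in addition, $f(\theta,\cdot)$ is a signed distance field, in the sense that it is continuous on $\mathbb{R}^d$ and $|f(\theta,x)|=\operatorname{dist}(x,S_\theta)$ for all $x\in\mathbb{R}^d$, or if it satisfies the eikonal equation $\|g(\theta,x)\|=1$ for all $x\in S_\theta\cap\Omega$, then $\mathcal{H}^{d-1}(S_\theta\cap\Omega)<\infty$ and the limit is the surface area in $\Omega$: $$\lim_{\alpha\to\infty}L_{\mathrm{SSA}}^\alpha(\theta)=\mathcal{H}^{d-1}(S_\theta\cap\Omega).$$ In particular, if $S_\theta\subset\Omega$, both right-hand sides are taken over the whole surface $S_\theta$. -/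

import Mathlib

open MeasureTheory Filter Topology

/-- The zero-level set `S_θ = {x | f θ x = 0}`. -/
def zeroLevelSet {Θ E : Type*} (f : Θ → E → ℝ) (θ : Θ) : Set E :=
  {x | f θ x = 0}

/-- The SSA loss `(α / 2) ∫_Ω exp (-α |f(θ, x)|) dx` (Lebesgue integral on `ℝᵈ`). -/
noncomputable def ssaLoss {Θ : Type*} {d : ℕ} (Ω : Set (EuclideanSpace ℝ (Fin d)))
    (f : Θ → EuclideanSpace ℝ (Fin d) → ℝ) (α : ℝ) (θ : Θ) : ℝ :=
  α / 2 * ∫ x in Ω, Real.exp (-α * |f θ x|)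

/-- `u` is a signed distance field: it is continuous (so that its sign can change only across its
zero-level set) and its absolute value at any point is the distance to its zero-level set.
The zero-level set of such a field is never empty: otherwise `Metric.infDist` would be `0`
everywhere, hence `u = 0` everywhere. -/
def IsSignedDistanceField {d : ℕ} (u : EuclideanSpace ℝ (Fin d) → ℝ) : Prop :=
  Continuous u ∧ ∀ x, |u x| = Metric.infDist x {y | u y = 0}

/-- The eikonal equation `‖∇u‖ = 1` at all points of `A`. -/
def SatisfiesEikonalOn {d : ℕ} (u : EuclideanSpace ℝ (Fin d) → ℝ)
    (A : Set (EuclideanSpace ℝ (Fin d))) : Prop :=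
  ∀ x ∈ A, ‖gradient u x‖ = 1

/-! As `α` grows, the weight concentrates on the zero set `S`. On a line crossing `S` at `s₀` with
slope `a ≠ 0`, the substitution `s = s₀ + τ / α` turns the weighted integral into one tending to `(1
/ 2) ∫ exp (-|a| |τ|) dτ = 1 / |a|` (`tendsto_exp_integral_of_hasDerivAt`).

The passage to the surface uses neither a coarea formula nor a parametrization. On a small ball
about a zero, the gradient stays within a fraction `ε` of its central value, of norm `c`. Fubini
along that direction and dominated convergence place the limit for a piece `A` between `V / ((1 + ε)
c)` and `V / ((1 - ε) c)`, where `V` is the volume of the orthogonal projection of `S ∩ A`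
(`NearlyAffineOn.exists_tendsto_exp_integral`). The projection is bi-Lipschitz on `S ∩ A` with
constants near 1, so the limit and the surface integral of `1 / ‖∇u‖` agree up to a factor `K` close
to 1 (`exists_closedBall_hasApproxLimit`).

Compactness of `S ∩ closure Ω` leaves finitely many pieces, and away from `S` the weight decays
exponentially (`hasApproxLimit_of_regular`). Letting `K` decrease to 1 gives equality. For a signed
distance field the integrand is 1 by `IsSignedDistanceField.norm_gradient_eq_one`. -/

/-! ### Laplace asymptotics in one variable. -/

theorem tendsto_mul_exp_neg_mul_atTop {δ : ℝ} (hδ : 0 < δ) (c : ℝ) :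
    Tendsto (fun α : ℝ => α / 2 * (Real.exp (-α * δ) * c)) atTop (𝓝 0) := by
  have h := (Real.tendsto_pow_mul_exp_neg_atTop_nhds_zero 1).comp
    (tendsto_id.atTop_mul_const hδ)
  have h2 := h.mul_const (c / (2 * δ))
  rw [zero_mul] at h2
  refine h2.congr fun α => ?_
  simp only [Function.comp, id, pow_one, neg_mul]
  field_simp

/-- Where `|u|` is bounded below, the exponential weight vanishes in the limit. -/
theorem tendsto_exp_integral_zero {X : Type*} [MeasurableSpace X] {μ : Measure X} {A : Set X}
    (hμ : μ A ≠ ⊤) {u : X → ℝ} {δ : ℝ} (hδ : 0 < δ)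
    (hu : ∀ x ∈ A, δ ≤ |u x|) :
    Tendsto (fun α : ℝ => α / 2 * ∫ x in A, Real.exp (-α * |u x|) ∂μ) atTop (𝓝 0) := by
  refine squeeze_zero' ?_ ?_ (tendsto_mul_exp_neg_mul_atTop hδ (μ.real A))
  · filter_upwards [eventually_ge_atTop 0] with α hα
    exact mul_nonneg (by positivity) (integral_nonneg fun x => (Real.exp_pos _).le)
  · filter_upwards [eventually_ge_atTop 0] with α hα
    refine mul_le_mul_of_nonneg_left ?_ (by positivity)
    have := norm_setIntegral_le_of_norm_le_const (μ := μ) (s := A)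
      (f := fun x => Real.exp (-α * |u x|)) (C := Real.exp (-α * δ)) (lt_top_iff_ne_top.2 hμ)
      (fun x hx => by
        rw [Real.norm_of_nonneg (Real.exp_pos _).le, Real.exp_le_exp]
        nlinarith [hu x hx])
    exact (le_abs_self _).trans this

theorem integrable_exp_neg_mul_abs {b : ℝ} (hb : 0 < b) :
    Integrable (fun s : ℝ => Real.exp (-b * |s|)) := by
  have h1 : IntegrableOn (fun s : ℝ => Real.exp (-b * |s|)) (Set.Ioi 0) :=
    (integrableOn_exp_mul_Ioi (a := -b) (by linarith) 0).congr_fun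
      (fun s hs => by simp only [abs_of_pos (Set.mem_Ioi.1 hs)]) measurableSet_Ioi
  have h2 : IntegrableOn (fun s : ℝ => Real.exp (-b * |s|)) (Set.Iic 0) :=
    (integrableOn_exp_mul_Iic (a := b) hb 0).congr_fun
      (fun s hs => by simp only [abs_of_nonpos (Set.mem_Iic.1 hs)]; congr 1; ring)
      measurableSet_Iic
  simpa using h2.union h1

theorem integral_exp_neg_mul_abs {b : ℝ} (hb : 0 < b) :
    ∫ s : ℝ, Real.exp (-b * |s|) = 2 / b := by
  rw [integral_comp_abs (f := fun s => Real.exp (-b * s)), integral_exp_mul_Ioi (by linarith)]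
  simp
  ring

/-- Uniform bound for the weighted length of a line slice. -/
theorem exp_integral_le {J : Set ℝ} (hJ : MeasurableSet J) {u : ℝ → ℝ} {m s₀ : ℝ} (hm : 0 < m)
    (hlow : ∀ s ∈ J, m * |s - s₀| ≤ |u s|) {α : ℝ} (hα : 0 < α) :
    α / 2 * ∫ s in J, Real.exp (-α * |u s|) ≤ 1 / m := by
  have hb : 0 < α * m := by positivity
  have hint : Integrable (fun s : ℝ => Real.exp (-(α * m) * |s - s₀|)) :=
    (integrable_exp_neg_mul_abs hb).comp_sub_right s₀
  have h1 : ∫ s in J, Real.exp (-α * |u s|) ≤ 2 / (α * m) := by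
    calc ∫ s in J, Real.exp (-α * |u s|)
        ≤ ∫ s in J, Real.exp (-(α * m) * |s - s₀|) := by
          refine integral_mono_of_nonneg (Eventually.of_forall fun s => (Real.exp_pos _).le)
            hint.integrableOn ?_
          refine (ae_restrict_iff' hJ).2 (Eventually.of_forall fun s hs => ?_)
          simp only [Real.exp_le_exp]
          nlinarith [hlow s hs]
      _ ≤ ∫ s : ℝ, Real.exp (-(α * m) * |s - s₀|) :=
          setIntegral_le_integral hint (Eventually.of_forall fun s => (Real.exp_pos _).le)
      _ = 2 / (α * m) := by
          rw [integral_sub_right_eq_self (fun s => Real.exp (-(α * m) * |s|)) s₀,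
            integral_exp_neg_mul_abs hb]
  calc α / 2 * ∫ s in J, Real.exp (-α * |u s|) ≤ α / 2 * (2 / (α * m)) := by gcongr
    _ = 1 / m := by field_simp

/-- Laplace asymptotics on a line through a transversal zero. -/
theorem tendsto_exp_integral_of_hasDerivAt {J : Set ℝ} (hJ : MeasurableSet J) {u : ℝ → ℝ}
    {m s₀ a : ℝ} (hm : 0 < m) (ha : a ≠ 0) (hlow : ∀ s ∈ J, m * |s - s₀| ≤ |u s|)
    (hmeas : ∀ α : ℝ, Measurable (J.indicator fun s => Real.exp (-α * |u s|)))
    (hJn : J ∈ 𝓝 s₀) (hu0 : u s₀ = 0) (hd : HasDerivAt u a s₀) :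
    Tendsto (fun α : ℝ => α / 2 * ∫ s in J, Real.exp (-α * |u s|)) atTop (𝓝 (1 / |a|)) := by
  -- The integrand rescaled by `s = s₀ + τ / α`; the indicator puts all `α` on one domain of
  -- integration.
  set F : ℝ → ℝ → ℝ := fun α τ =>
    J.indicator (fun s => Real.exp (-α * |u s|)) (s₀ + α⁻¹ * τ) with hF
  have hsub : ∀ᶠ α : ℝ in atTop,
      1 / 2 * ∫ τ, F α τ = α / 2 * ∫ s in J, Real.exp (-α * |u s|) := by
    filter_upwards [eventually_gt_atTop 0] with α hα
    have h1 := Measure.integral_comp_mul_left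
      (fun s => J.indicator (fun s => Real.exp (-α * |u s|)) (s₀ + s)) α⁻¹
    rw [integral_add_left_eq_self (J.indicator (fun s => Real.exp (-α * |u s|))) s₀,
      integral_indicator hJ, inv_inv, abs_of_pos hα, smul_eq_mul] at h1
    rw [h1]; ring
  have hlim : Tendsto (fun α => ∫ τ, F α τ) atTop (𝓝 (∫ τ : ℝ, Real.exp (-|a| * |τ|))) := by
    refine tendsto_integral_filter_of_dominated_convergence (fun τ => Real.exp (-m * |τ|))
      ?_ ?_ (integrable_exp_neg_mul_abs hm) ?_
    · exact Eventually.of_forall fun α =>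
        ((hmeas α).comp (by fun_prop)).aestronglyMeasurable
    · filter_upwards [eventually_gt_atTop 0] with α hα
      refine Eventually.of_forall fun τ => ?_
      by_cases hτ : s₀ + α⁻¹ * τ ∈ J
      · simp only [hF, Set.indicator_of_mem hτ]
        rw [Real.norm_of_nonneg (Real.exp_pos _).le, Real.exp_le_exp]
        have := hlow _ hτ
        rw [add_sub_cancel_left, abs_mul, abs_inv, abs_of_pos hα] at this
        have h2 : m * |τ| ≤ α * |u (s₀ + α⁻¹ * τ)| := by
          calc m * |τ| = α * (m * (α⁻¹ * |τ|)) := by field_simp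
            _ ≤ _ := by gcongr
        linarith
      · simp only [hF, Set.indicator_of_notMem hτ, norm_zero]
        positivity
    · refine Eventually.of_forall fun τ => ?_
      have hto : Tendsto (fun α : ℝ => s₀ + α⁻¹ * τ) atTop (𝓝 s₀) := by
        simpa using (tendsto_inv_atTop_zero.mul_const τ).const_add s₀
      -- Since `u s₀ = 0`, this is the difference quotient with increment `α⁻¹`.
      have hquot : Tendsto (fun α : ℝ => α * u (s₀ + α⁻¹ * τ)) atTop (𝓝 (τ * a)) := by
        have h0 : HasDerivAt (fun t : ℝ => u (s₀ + t * τ)) (a * τ) 0 := by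
          have hin : HasDerivAt (fun t : ℝ => s₀ + t * τ) τ 0 := by
            simpa using ((hasDerivAt_id (0 : ℝ)).mul_const τ).const_add s₀
          have hd' : HasDerivAt u a (s₀ + 0 * τ) := by simpa using hd
          exact hd'.comp (0 : ℝ) hin
        have h1 := h0.tendsto_slope_zero.comp
          (tendsto_inv_atTop_nhdsGT_zero.mono_right (nhdsGT_le_nhdsNE (0 : ℝ)))
        rw [mul_comm]
        refine h1.congr fun α => ?_
        simp [hu0]
      have hexp : Tendsto (fun α : ℝ => Real.exp (-|α * u (s₀ + α⁻¹ * τ)|)) atTop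
          (𝓝 (Real.exp (-|τ * a|))) :=
        (Real.continuous_exp.tendsto _).comp hquot.abs.neg
      rw [abs_mul, mul_comm |τ|, ← neg_mul] at hexp
      refine hexp.congr' ?_
      filter_upwards [hto.eventually hJn, eventually_gt_atTop 0] with α h1 h2
      simp only [hF]
      rw [Set.indicator_of_mem (show s₀ + α⁻¹ * τ ∈ J from h1), abs_mul, abs_of_pos h2, neg_mul]
  rw [integral_exp_neg_mul_abs (abs_pos.2 ha)] at hlim
  have := (hlim.const_mul (1 / 2)).congr' hsub
  convert this using 2
  field_simp

/-! ### Orthogonal projection and Hausdorff measure under Lipschitz maps. -/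

/-- Orthogonal splitting of `ℝⁿ⁺¹` into a hyperplane and the line spanned by a unit vector. -/
theorem exists_measurePreserving_hyperplane_splitting {n : ℕ} {ν : EuclideanSpace ℝ (Fin (n + 1))}
    (hν : ‖ν‖ = 1) :
    ∃ (P : EuclideanSpace ℝ (Fin (n + 1)) →L[ℝ] EuclideanSpace ℝ (Fin n))
      (e : EuclideanSpace ℝ (Fin (n + 1)) ≃ᵐ EuclideanSpace ℝ (Fin n) × ℝ),
      MeasurePreserving e ∧ (∀ x, e x = (P x, inner ℝ ν x)) ∧
      ∀ x, ‖x‖ ^ 2 = ‖P x‖ ^ 2 + (inner ℝ ν x) ^ 2 := by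
  -- Only the index 0 is prescribed, so the constant family `ν` is orthonormal on `{0}`.
  obtain ⟨b, hb⟩ := Orthonormal.exists_orthonormalBasis_extension_of_card_eq (𝕜 := ℝ)
    (E := EuclideanSpace ℝ (Fin (n + 1))) (ι := Fin (n + 1)) (by simp)
    (v := fun _ => ν) (s := {0}) (by
      constructor
      · intro i; simpa using hν
      · intro i j hij
        exact absurd (Subsingleton.elim i j) hij)
  have hb0 : b 0 = ν := hb 0 rfl
  let P : EuclideanSpace ℝ (Fin (n + 1)) →L[ℝ] EuclideanSpace ℝ (Fin n) :=
    LinearMap.toContinuousLinearMap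
      { toFun := fun x => WithLp.toLp 2 fun i : Fin n => b.repr x i.succ
        map_add' := fun x y => by ext i; simp
        map_smul' := fun c x => by ext i; simp }
  let e : EuclideanSpace ℝ (Fin (n + 1)) ≃ᵐ EuclideanSpace ℝ (Fin n) × ℝ :=
    b.measurableEquiv.trans <| (MeasurableEquiv.toLp 2 (Fin (n + 1) → ℝ)).symm.trans <|
      (MeasurableEquiv.piFinSuccAbove (fun _ => ℝ) 0).trans <|
      MeasurableEquiv.prodComm.trans <|
      (MeasurableEquiv.toLp 2 (Fin n → ℝ)).prodCongr (MeasurableEquiv.refl ℝ)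
  have hPi : ∀ x i, P x i = b.repr x i.succ := fun x i => rfl
  have h0 : ∀ x, b.repr x 0 = inner ℝ ν x := fun x => by rw [b.repr_apply_apply, hb0]
  refine ⟨P, e, ?_, ?_, ?_⟩
  · refine b.measurePreserving_measurableEquiv.trans ?_
    refine (EuclideanSpace.volume_preserving_symm_measurableEquiv_toLp _).trans ?_
    refine (volume_preserving_piFinSuccAbove (fun _ => ℝ) 0).trans ?_
    refine Measure.measurePreserving_swap.trans ?_
    exact ((EuclideanSpace.volume_preserving_symm_measurableEquiv_toLp (Fin n)).symm).prod
      (MeasurePreserving.id volume)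
  · intro x
    refine Prod.ext ?_ ?_
    · ext i
      rw [hPi]
      rfl
    · rw [← h0]
      rfl
  · intro x
    rw [← b.repr.norm_map x, EuclideanSpace.norm_sq_eq, EuclideanSpace.norm_sq_eq,
      Fin.sum_univ_succ, ← h0]
    simp only [hPi, Real.norm_eq_abs, sq_abs]
    ring

theorem LipschitzOnWith.euclideanHausdorffMeasure_image_le {X Y : Type*} [EMetricSpace X]
    [EMetricSpace Y] [MeasurableSpace X] [BorelSpace X] [MeasurableSpace Y] [BorelSpace Y]
    {K : NNReal} {f : X → Y} {s : Set X} (h : LipschitzOnWith K f s) (d : ℕ) :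
    μHE[d] (f '' s) ≤ (K : ENNReal) ^ d * μHE[d] s := by
  simp only [Measure.euclideanHausdorffMeasure_def, Measure.smul_apply, ENNReal.smul_def,
    smul_eq_mul]
  have := h.hausdorffMeasure_image_le (d := d) (by positivity)
  rw [ENNReal.rpow_natCast] at this
  calc _ ≤ _ * ((K : ENNReal) ^ d * μH[d] s) := by gcongr
    _ = _ := by ring

/-- Such an `f` is injective on `s` with a `K`-Lipschitz inverse. This bounds the measure of a
surface piece by that of its projection. -/
theorem euclideanHausdorffMeasure_le_of_dist_le {X Y : Type*} [MetricSpace X]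
    [MetricSpace Y] [MeasurableSpace X] [BorelSpace X] [MeasurableSpace Y] [BorelSpace Y]
    {K : NNReal} {f : X → Y} {s : Set X}
    (h : ∀ x ∈ s, ∀ y ∈ s, dist x y ≤ K * dist (f x) (f y)) (d : ℕ) :
    μHE[d] s ≤ (K : ENNReal) ^ d * μHE[d] (f '' s) := by
  rcases s.eq_empty_or_nonempty with rfl | ⟨x₀, _⟩
  · simp
  have : Nonempty X := ⟨x₀⟩
  have hinj : Set.InjOn f s := fun x hx y hy hxy => by
    have := h x hx y hy
    rw [hxy, dist_self, mul_zero] at this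
    exact dist_le_zero.1 this
  have hL : LipschitzOnWith K (Function.invFunOn f s) (f '' s) := by
    refine LipschitzOnWith.of_dist_le_mul ?_
    rintro _ ⟨x, hx, rfl⟩ _ ⟨y, hy, rfl⟩
    rw [hinj.leftInvOn_invFunOn hx, hinj.leftInvOn_invFunOn hy]
    exact h x hx y hy
  have := hL.euclideanHausdorffMeasure_image_le d
  rwa [hinj.leftInvOn_invFunOn.image_image] at this

/-! ### Weighted volume of a piece on which the field is nearly affine. -/

section

variable {n : ℕ}

/-- On the set `B` the gradient of `u` deviates from its value at `x₀` by at most the fraction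
`ε`, both pointwise and for difference quotients. -/
structure NearlyAffineOn (u : EuclideanSpace ℝ (Fin n) → ℝ) (x₀ : EuclideanSpace ℝ (Fin n))
    (ε : ℝ) (B : Set (EuclideanSpace ℝ (Fin n))) : Prop where
  contDiffAt : ∀ x ∈ B, ContDiffAt ℝ 1 u x
  norm_gradient_sub_le : ∀ x ∈ B, ‖gradient u x - gradient u x₀‖ ≤ ε * ‖gradient u x₀‖
  abs_sub_inner_le : ∀ x ∈ B, ∀ y ∈ B,
    |u x - u y - inner ℝ (gradient u x₀) (x - y)| ≤ ε * ‖gradient u x₀‖ * ‖x - y‖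

theorem ContDiffAt.continuousAt_gradient {u : EuclideanSpace ℝ (Fin n) → ℝ}
    {x : EuclideanSpace ℝ (Fin n)} (h : ContDiffAt ℝ 1 u x) : ContinuousAt (gradient u) x := by
  have h1 : ContinuousAt (fderiv ℝ u) x := (h.fderiv_right (m := 0) (by norm_num)).continuousAt
  exact (InnerProductSpace.toDual ℝ _).symm.continuous.continuousAt.comp h1

theorem inner_gradient_eq_fderiv {u : EuclideanSpace ℝ (Fin n) → ℝ}
    (x y : EuclideanSpace ℝ (Fin n)) : inner ℝ (gradient u x) y = fderiv ℝ u x y := by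
  simp [gradient]

/-- Strict differentiability controls the increments between any two points near `x₀`, not only
those starting at `x₀`. -/
theorem ContDiffAt.exists_nearlyAffineOn {u : EuclideanSpace ℝ (Fin n) → ℝ}
    {x₀ : EuclideanSpace ℝ (Fin n)} (h : ContDiffAt ℝ 1 u x₀) (hg : gradient u x₀ ≠ 0)
    {ε : ℝ} (hε : 0 < ε) : ∃ r > 0, NearlyAffineOn u x₀ ε (Metric.closedBall x₀ r) := by
  have hc : 0 < ε * ‖gradient u x₀‖ := mul_pos hε (norm_pos_iff.2 hg)
  obtain ⟨s, hs, hs'⟩ := (h.hasStrictFDerivAt (by norm_num)).approximates_deriv_on_nhds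
    (c := ⟨ε * ‖gradient u x₀‖, hc.le⟩) (Or.inr hc)
  have h1 : ∀ᶠ x in 𝓝 x₀, ContDiffAt ℝ 1 u x := h.eventually (by decide)
  have h2 : ∀ᶠ x in 𝓝 x₀, ‖gradient u x - gradient u x₀‖ < ε * ‖gradient u x₀‖ := by
    have := (Metric.tendsto_nhds.1 h.continuousAt_gradient.tendsto) _ hc
    simpa [dist_eq_norm] using this
  obtain ⟨r, hr, hrs⟩ := Metric.nhds_basis_closedBall.mem_iff.1
    (inter_mem hs (inter_mem h1 h2))
  refine ⟨r, hr, fun x hx => (hrs hx).2.1, fun x hx => (hrs hx).2.2.le, fun x hx y hy => ?_⟩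
  have := hs' x (hrs hx).1 y (hrs hy).1
  rw [inner_gradient_eq_fderiv]
  exact this

section
variable {u : EuclideanSpace ℝ (Fin (n + 1)) → ℝ} {x₀ : EuclideanSpace ℝ (Fin (n + 1))} {ε r : ℝ}

/-- Weighted volume of a small piece `A`, compared with the `n`-volume of the projection of
`A ∩ {u = 0}` along the gradient at the centre. -/
theorem NearlyAffineOn.exists_tendsto_exp_integral
    (h : NearlyAffineOn u x₀ ε (Metric.closedBall x₀ r)) (hg : gradient u x₀ ≠ 0)
    (hε : 0 < ε) (hε1 : ε < 1)
    {P : EuclideanSpace ℝ (Fin (n + 1)) →L[ℝ] EuclideanSpace ℝ (Fin n)}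
    {e : EuclideanSpace ℝ (Fin (n + 1)) ≃ᵐ EuclideanSpace ℝ (Fin n) × ℝ}
    {ν : EuclideanSpace ℝ (Fin (n + 1))} (hν : ‖ν‖ = 1) (hgν : gradient u x₀ = ‖gradient u x₀‖ • ν)
    (he : MeasurePreserving e) (hPe : ∀ x, e x = (P x, inner ℝ ν x))
    (hP : ∀ x, ‖x‖ ^ 2 = ‖P x‖ ^ 2 + (inner ℝ ν x) ^ 2)
    {A : Set (EuclideanSpace ℝ (Fin (n + 1)))} (hA : MeasurableSet A)
    (hAB : A ⊆ Metric.closedBall x₀ r)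
    (hnull : volume (P '' ({x | u x = 0} ∩ frontier A)) = 0)
    (hm : MeasurableSet (P '' ({x | u x = 0} ∩ A)))
    (hfin : volume (P '' ({x | u x = 0} ∩ A)) ≠ ⊤) :
    ∃ L, Tendsto (fun α : ℝ => α / 2 * ∫ x in A, Real.exp (-α * |u x|)) atTop (𝓝 L) ∧
      volume.real (P '' ({x | u x = 0} ∩ A)) * (1 / ((1 + ε) * ‖gradient u x₀‖)) ≤ L ∧
      L ≤ volume.real (P '' ({x | u x = 0} ∩ A)) * (1 / ((1 - ε) * ‖gradient u x₀‖)) := by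
  set c := ‖gradient u x₀‖ with hc
  have hc0 : 0 < c := norm_pos_iff.2 hg
  set B := Metric.closedBall x₀ r with hB
  have hm0 : 0 < (1 - ε) * c := mul_pos (by linarith) hc0
  have hνν : inner ℝ ν ν = (1 : ℝ) := by rw [real_inner_self_eq_norm_sq, hν]; norm_num
  have hPν : P ν = 0 := by
    have := hP ν
    rw [hν, hνν] at this
    exact norm_eq_zero.1 (pow_eq_zero_iff two_ne_zero |>.1 (by linarith))
  have hPs : ∀ y s, P (e.symm (y, s)) = y := fun y s => by
    have := hPe (e.symm (y, s)); rw [e.apply_symm_apply] at this; exact (congrArg Prod.fst this).symm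
  have hνs : ∀ y s, inner ℝ ν (e.symm (y, s)) = s := fun y s => by
    have := hPe (e.symm (y, s)); rw [e.apply_symm_apply] at this; exact (congrArg Prod.snd this).symm
  have hline : ∀ y s t, e.symm (y, s) = e.symm (y, t) + (s - t) • ν := fun y s t => by
    apply e.injective
    rw [hPe, hPe, map_add, map_smul, hPν, inner_add_right, inner_smul_right, hνν, hPs, hPs, hνs,
      hνs]
    simp
  have hlinec : ∀ y, Continuous fun s => e.symm (y, s) := fun y => by
    have : (fun s => e.symm (y, s)) = fun s => e.symm (y, 0) + (s - 0) • ν :=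
      funext fun s => hline y s 0
    rw [this]; fun_prop
  -- Along the direction `ν` the field changes at rate at least `(1 - ε) c`: each line meets `S` at
  -- most once in `B`, and transversally.
  have hlow : ∀ y s t, e.symm (y, s) ∈ B → e.symm (y, t) ∈ B →
      (1 - ε) * c * |s - t| ≤ |u (e.symm (y, s)) - u (e.symm (y, t))| := fun y s t hs ht => by
    have h1 := h.abs_sub_inner_le _ hs _ ht
    have h2 : e.symm (y, s) - e.symm (y, t) = (s - t) • ν := by rw [hline y s t]; simp
    rw [h2, hgν, inner_smul_left, inner_smul_right, hνν, norm_smul, hν, norm_smul, hν] at h1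
    simp only [conj_trivial, mul_one, Real.norm_eq_abs] at h1
    rw [abs_of_pos hc0] at h1
    have h3 : |c * (s - t)| = c * |s - t| := by rw [abs_mul, abs_of_pos hc0]
    have h4 := abs_sub_abs_le_abs_sub (c * (s - t)) (u (e.symm (y, s)) - u (e.symm (y, t)))
    rw [abs_sub_comm] at h1
    linarith
  have hBc : IsCompact B := isCompact_closedBall _ _
  have huB : ContinuousOn u B := fun x hx => (h.contDiffAt x hx).continuousAt.continuousWithinAt
  have hDc : ∀ y, ∀ C ⊆ B, IsClosed C → IsCompact {s | e.symm (y, s) ∈ C} := fun y C hCB hC => by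
    refine (isCompact_closedBall (inner ℝ ν x₀) r).of_isClosed_subset
      (hC.preimage (hlinec y)) fun s hs => ?_
    have h1 : dist (e.symm (y, s)) x₀ ≤ r := hCB hs
    rw [Metric.mem_closedBall, Real.dist_eq, ← hνs y s, ← inner_sub_right]
    refine (abs_real_inner_le_norm _ _).trans ?_
    rwa [hν, one_mul, ← dist_eq_norm]
  -- Continuity of `u` is known only on `B`, so measurability is obtained by extending by 0 from `B`
  -- and then restricting to `A`.
  have huM : ∀ α : ℝ, Measurable (A.indicator fun x => Real.exp (-α * |u x|)) := fun α => by
    classical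
    have h1 : Measurable (B.piecewise (fun x => Real.exp (-α * |u x|)) fun _ => 0) :=
      ContinuousOn.measurable_piecewise
        (Real.continuous_exp.comp_continuousOn (huB.abs.const_mul _))
        continuousOn_const hBc.measurableSet
    convert h1.indicator hA using 1
    ext x
    by_cases hx : x ∈ A
    · simp [hx, hAB hx]
    · simp [hx]
  set J : EuclideanSpace ℝ (Fin n) → Set ℝ := fun y => {s | e.symm (y, s) ∈ A} with hJ
  have hJm : ∀ y, MeasurableSet (J y) := fun y => (hlinec y).measurable hA
  set F : ℝ → EuclideanSpace ℝ (Fin n) → ℝ := fun α y =>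
    α / 2 * ∫ s in J y, Real.exp (-α * |u (e.symm (y, s))|) with hF
  have hF' : ∀ α y, F α y =
      α / 2 * ∫ s, A.indicator (fun x => Real.exp (-α * |u x|)) (e.symm (y, s)) := fun α y => by
    simp only [hF]
    rw [← integral_indicator (hJm y)]
    rfl
  have hvolA : volume A < ⊤ := (measure_mono hAB).trans_lt hBc.measure_lt_top
  have hfub : ∀ α : ℝ, 0 < α →
      ∫ y, F α y = α / 2 * ∫ x in A, Real.exp (-α * |u x|) := fun α hα => by
    have hint : Integrable (A.indicator fun x => Real.exp (-α * |u x|)) := by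
      have h1 : Integrable (A.indicator fun _ => (1 : ℝ)) :=
        (integrable_indicator_iff hA).2 (integrableOn_const hvolA.ne)
      refine h1.mono' (huM α).aestronglyMeasurable (Eventually.of_forall fun x => ?_)
      by_cases hx : x ∈ A
      · simp only [Set.indicator_of_mem hx]
        rw [Real.norm_of_nonneg (Real.exp_pos _).le, Real.exp_le_one_iff]
        nlinarith [abs_nonneg (u x)]
      · simp [hx]
    have hint' := (he.symm e).integrable_comp_of_integrable hint
    simp_rw [hF']
    rw [integral_const_mul, ← integral_indicator hA, ← (he.symm e).integral_comp']
    congr 1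
    exact (integral_prod _ hint').symm
  have hbound : ∀ α : ℝ, 0 < α → ∀ y, ‖F α y‖ ≤
      (Metric.closedBall (P x₀) r).indicator (fun _ => 1 / ((1 - ε) * c / 2)) y := fun α hα y => by
    have hFnn : 0 ≤ F α y := mul_nonneg (by positivity) (integral_nonneg fun s =>
      (Real.exp_pos _).le)
    rw [Real.norm_of_nonneg hFnn]
    rcases Set.eq_empty_or_nonempty {s | e.symm (y, s) ∈ B} with hD | hD
    · have : J y = ∅ := Set.eq_empty_of_forall_notMem fun s hs => by
        have : s ∈ {s | e.symm (y, s) ∈ B} := hAB hs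
        rw [hD] at this; exact this
      simp only [hF, this, Measure.restrict_empty, integral_zero_measure, mul_zero]
      exact Set.indicator_nonneg (fun _ _ => by positivity) _
    · have hy : y ∈ Metric.closedBall (P x₀) r := by
        obtain ⟨s, hs⟩ := hD
        have h1 : dist (e.symm (y, s)) x₀ ≤ r := hs
        rw [Metric.mem_closedBall, dist_eq_norm, ← hPs y s, ← map_sub]
        rw [dist_eq_norm] at h1
        refine le_trans ?_ h1
        refine abs_le_of_sq_le_sq' ?_ (norm_nonneg _) |>.2
        rw [hP (e.symm (y, s) - x₀)]
        nlinarith [sq_nonneg (inner ℝ ν (e.symm (y, s) - x₀))]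
      rw [Set.indicator_of_mem hy]
      -- The line may miss `S`, so a minimum `t` of `|u|` replaces the zero. There `|u s - u t| ≤ 2
      -- |u s|`, whence the factor `1 / 2` in the slope.
      obtain ⟨t, ht, htm⟩ := (hDc y B subset_rfl Metric.isClosed_closedBall).exists_isMinOn hD
        (f := fun s => |u (e.symm (y, s))|)
        ((huB.comp (hlinec y).continuousOn fun s hs => hs).abs)
      refine exp_integral_le (hJm y) (by positivity) (s₀ := t) (fun s hs => ?_) hα
      have h1 := hlow y s t (hAB hs) ht
      have h2 : |u (e.symm (y, t))| ≤ |u (e.symm (y, s))| := htm (hAB hs)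
      have h3 := abs_sub (u (e.symm (y, s))) (u (e.symm (y, t)))
      linarith
  -- Off the null projection of `{x | u x = 0} ∩ frontier A`, any zero over `y` in `closure A` is
  -- interior to `A`. Either there is one, and the one-variable limit applies, or `|u|` is bounded
  -- below on the compact slice and the limit is 0.
  have hlimit : ∀ᵐ y, ∃ l, Tendsto (fun α => F α y) atTop (𝓝 l) ∧
      (P '' ({x | u x = 0} ∩ A)).indicator (fun _ => 1 / ((1 + ε) * c)) y ≤ l ∧
      l ≤ (P '' ({x | u x = 0} ∩ A)).indicator (fun _ => 1 / ((1 - ε) * c)) y := by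
    filter_upwards [measure_eq_zero_iff_ae_notMem.1 hnull] with y hy
    by_cases hyA : y ∈ P '' ({x | u x = 0} ∩ A)
    · obtain ⟨x, ⟨hx0, hxA⟩, rfl⟩ := hyA
      have hx0 : u x = 0 := hx0
      have hmem : P x ∈ P '' ({x | u x = 0} ∩ A) := ⟨x, ⟨hx0, hxA⟩, rfl⟩
      rw [Set.indicator_of_mem hmem, Set.indicator_of_mem hmem]
      have hxs : e.symm (P x, inner ℝ ν x) = x := by rw [← hPe, e.symm_apply_apply]
      have hxi : A ∈ 𝓝 x := by
        by_contra hcon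
        exact hy ⟨x, ⟨hx0, subset_closure hxA, fun hi => hcon (mem_interior_iff_mem_nhds.1 hi)⟩, rfl⟩
      have hder : HasDerivAt (fun s => u (e.symm (P x, s))) (inner ℝ (gradient u x) ν)
          (inner ℝ ν x) := by
        have h1 : HasFDerivAt u (fderiv ℝ u x) (e.symm (P x, inner ℝ ν x)) := by
          rw [hxs]
          exact ((h.contDiffAt x (hAB hxA)).differentiableAt (by norm_num)).hasFDerivAt
        have h2 : HasDerivAt (fun s => e.symm (P x, s)) ν (inner ℝ ν x) := by
          have : (fun s => e.symm (P x, s)) = fun s => e.symm (P x, 0) + (s - 0) • ν :=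
            funext fun s => hline _ s 0
          rw [this]
          simpa using (((hasDerivAt_id (inner ℝ ν x : ℝ)).sub_const (0 : ℝ)).smul_const ν).const_add
            (e.symm (P x, 0))
        rw [inner_gradient_eq_fderiv]
        exact h1.comp_hasDerivAt (inner ℝ ν x : ℝ) h2
      set a : ℝ := inner ℝ (gradient u x) ν with ha
      have hac : |a - c| ≤ ε * c := by
        have h1 : a - c = inner ℝ (gradient u x - gradient u x₀) ν := by
          rw [inner_sub_left, ← ha, hgν, inner_smul_left, hνν]
          simp [hc]
        rw [h1]
        refine (abs_real_inner_le_norm _ _).trans ?_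
        rw [hν, mul_one]
        exact h.norm_gradient_sub_le x (hAB hxA)
      rw [abs_le] at hac
      have ha0 : 0 < a := by nlinarith
      refine ⟨1 / |a|, tendsto_exp_integral_of_hasDerivAt (hJm _) hm0 ha0.ne'
        (s₀ := inner ℝ ν x) (fun s hs => ?_) (fun α => ?_) ?_ ?_ hder, ?_, ?_⟩
      · have := hlow (P x) s (inner ℝ ν x) (hAB hs) (by rw [hxs]; exact hAB hxA)
        rwa [hxs, hx0, sub_zero] at this
      · exact (huM α).comp (hlinec (P x)).measurable
      · exact (hlinec (P x)).continuousAt.preimage_mem_nhds (by rw [hxs]; exact hxi)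
      · rw [hxs, hx0]
      · rw [abs_of_pos ha0]
        exact one_div_le_one_div_of_le ha0 (by linarith)
      · rw [abs_of_pos ha0]
        exact one_div_le_one_div_of_le hm0 (by linarith)
    · refine ⟨0, ?_, by rw [Set.indicator_of_notMem hyA], by rw [Set.indicator_of_notMem hyA]⟩
      have hclB : closure A ⊆ B := closure_minimal hAB Metric.isClosed_closedBall
      have hK := hDc y (closure A) hclB isClosed_closure
      have hne : ∀ s ∈ {s | e.symm (y, s) ∈ closure A}, u (e.symm (y, s)) ≠ 0 := fun s hs h0 => by
        by_cases hsA : e.symm (y, s) ∈ A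
        · exact hyA ⟨_, ⟨h0, hsA⟩, hPs y s⟩
        · exact hy ⟨_, ⟨h0, hs, fun hi => hsA (interior_subset hi)⟩, hPs y s⟩
      have hco : ContinuousOn (fun s => |u (e.symm (y, s))|) {s | e.symm (y, s) ∈ closure A} :=
        ((huB.mono hclB).comp (hlinec y).continuousOn fun s hs => hs).abs
      have hJsub : J y ⊆ {s | e.symm (y, s) ∈ closure A} := fun s hs => subset_closure hs
      have hJfin : volume (J y) ≠ ⊤ := ((measure_mono hJsub).trans_lt hK.measure_lt_top).ne
      obtain ⟨δ, hδ, hδ'⟩ := hK.exists_forall_le' hco (a := 0) fun s hs => abs_pos.2 (hne s hs)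
      exact tendsto_exp_integral_zero hJfin hδ fun s hs => hδ' s (hJsub hs)
  obtain ⟨G, hG⟩ := hlimit.choice
  have hFm : ∀ α, StronglyMeasurable (F α) := fun α => by
    have h1 : StronglyMeasurable fun p : EuclideanSpace ℝ (Fin n) × ℝ =>
        A.indicator (fun x => Real.exp (-α * |u x|)) (e.symm p) :=
      ((huM α).comp e.symm.measurable).stronglyMeasurable
    have h2 := (h1.integral_prod_right' (ν := volume)).const_mul (α / 2)
    have h3 : F α = fun y => α / 2 *
      ∫ s, A.indicator (fun x => Real.exp (-α * |u x|)) (e.symm (y, s)) := funext (hF' α)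
    rw [h3]; exact h2
  have hbint : Integrable ((Metric.closedBall (P x₀) r).indicator
      (fun _ : EuclideanSpace ℝ (Fin n) => 1 / ((1 - ε) * c / 2))) :=
    (integrable_indicator_iff Metric.isClosed_closedBall.measurableSet).2
      (integrableOn_const (isCompact_closedBall _ _).measure_lt_top.ne)
  have hDCT : Tendsto (fun α => ∫ y, F α y) atTop (𝓝 (∫ y, G y)) :=
    tendsto_integral_filter_of_dominated_convergence _
      (Eventually.of_forall fun α => (hFm α).aestronglyMeasurable)
      (by filter_upwards [eventually_gt_atTop 0] with α hα
          exact Eventually.of_forall (hbound α hα)) hbint (hG.mono fun y hy => hy.1)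
  have hGm : AEStronglyMeasurable G :=
    (aemeasurable_of_tendsto_metrizable_ae (atTop : Filter ℝ)
      (fun α => (hFm α).measurable.aemeasurable) (hG.mono fun y hy => hy.1)).aestronglyMeasurable
  have hi : ∀ k : ℝ, Integrable ((P '' ({x | u x = 0} ∩ A)).indicator fun _ => k) := fun k =>
    (integrable_indicator_iff hm).2 (integrableOn_const hfin)
  have hGi : Integrable G := by
    refine (hi (1 / ((1 - ε) * c))).mono' hGm (hG.mono fun y hy => ?_)
    rw [Real.norm_of_nonneg (le_trans (Set.indicator_nonneg (fun _ _ => by positivity) _) hy.2.1)]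
    exact hy.2.2
  have hik : ∀ k : ℝ, ∫ y, (P '' ({x | u x = 0} ∩ A)).indicator (fun _ => k) y =
      volume.real (P '' ({x | u x = 0} ∩ A)) * k := fun k => by
    rw [integral_indicator hm, setIntegral_const, smul_eq_mul]
  refine ⟨∫ y, G y, hDCT.congr' ?_, ?_, ?_⟩
  · filter_upwards [eventually_gt_atTop 0] with α hα using hfub α hα
  · rw [← hik]
    exact integral_mono_ae (hi _) hGi (hG.mono fun y hy => hy.2.1)
  · rw [← hik]
    exact integral_mono_ae hGi (hi _) (hG.mono fun y hy => hy.2.2)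
end

/-! ### Local comparison with the surface integral. -/

/-- The first factor bounds the oscillation of `‖∇u‖`, the second the distortion of `n`-volume by
the projection. Their product is continuous at `ε = 0`, with value 1. -/
theorem exists_small_distortion (n : ℕ) {K : ℝ} (hK : 1 < K) :
    ∃ ε : ℝ, 0 < ε ∧ ε < 1 ∧ (1 + ε) / (1 - ε) * ((1 - ε)⁻¹) ^ n < K := by
  have h : ContinuousAt (fun ε : ℝ => (1 + ε) / (1 - ε) * ((1 - ε)⁻¹) ^ n) 0 := by
    have h0 : (1 : ℝ) - 0 ≠ 0 := by norm_num
    fun_prop (disch := exact h0)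
  have h1 := h.eventually_lt_const (u := K) (by simpa using hK)
  have h2 : ∀ᶠ ε : ℝ in 𝓝[>] 0, ε < 1 :=
    nhdsWithin_le_nhds (eventually_lt_nhds one_pos)
  obtain ⟨ε, h1, h2, h3⟩ := ((h1.filter_mono nhdsWithin_le_nhds).and (h2.and self_mem_nhdsWithin)).exists
  exact ⟨ε, h3, h2, h1⟩

/-- `A` carries a limit of the weighted volumes that agrees up to the factor `K` with the
integral of `1 / ‖∇u‖` over `A ∩ {u = 0}`. -/
def HasApproxLimit (u : EuclideanSpace ℝ (Fin (n + 1)) → ℝ) (K : ℝ)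
    (A : Set (EuclideanSpace ℝ (Fin (n + 1)))) : Prop :=
  IntegrableOn (fun x => 1 / ‖gradient u x‖) ({x | u x = 0} ∩ A) μHE[n] ∧
  ∃ L, Tendsto (fun α : ℝ => α / 2 * ∫ x in A, Real.exp (-α * |u x|)) atTop (𝓝 L) ∧
    L ≤ K * ∫ x in {x | u x = 0} ∩ A, 1 / ‖gradient u x‖ ∂μHE[n] ∧
    ∫ x in {x | u x = 0} ∩ A, 1 / ‖gradient u x‖ ∂μHE[n] ≤ K * L

/-- One radius serves all pieces `A` in the ball, which lets the pieces be cut freely when gluing.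
-/
theorem exists_closedBall_hasApproxLimit {u : EuclideanSpace ℝ (Fin (n + 1)) → ℝ}
    {x₀ : EuclideanSpace ℝ (Fin (n + 1))} (hu : ContDiffAt ℝ 1 u x₀) (hg : gradient u x₀ ≠ 0)
    {K : ℝ} (hK : 1 < K) :
    ∃ r > 0, μHE[n] ({x | u x = 0} ∩ Metric.closedBall x₀ r) < ⊤ ∧
      ∀ A ⊆ Metric.closedBall x₀ r, MeasurableSet A → μHE[n] ({x | u x = 0} ∩ frontier A) = 0 →
        HasApproxLimit u K A ∧ MeasurableSet ({x | u x = 0} ∩ A) := by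
  obtain ⟨ε, hε, hε1, hεK⟩ := exists_small_distortion n hK
  obtain ⟨r, hr, h⟩ := hu.exists_nearlyAffineOn hg hε
  set c := ‖gradient u x₀‖ with hc
  have hc0 : 0 < c := norm_pos_iff.2 hg
  set ν := c⁻¹ • gradient u x₀ with hνdef
  have hν : ‖ν‖ = 1 := by
    rw [hνdef, norm_smul, norm_inv, Real.norm_of_nonneg hc0.le, ← hc, inv_mul_cancel₀ hc0.ne']
  have hgν : gradient u x₀ = c • ν := by rw [hνdef, smul_inv_smul₀ hc0.ne']
  obtain ⟨P, e, he, hPe, hP⟩ := exists_measurePreserving_hyperplane_splitting hν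
  set S := {x | u x = 0} with hS
  set B := Metric.closedBall x₀ r with hB
  have huB : ContinuousOn u B := fun x hx => (h.contDiffAt x hx).continuousAt.continuousWithinAt
  have hSB : IsClosed (B ∩ S) := huB.preimage_isClosed_of_isClosed Metric.isClosed_closedBall
    (isClosed_singleton (x := (0 : ℝ)))
  have hP1 : ∀ x, ‖P x‖ ≤ ‖x‖ := fun x => by
    refine abs_le_of_sq_le_sq' ?_ (norm_nonneg _) |>.2
    nlinarith [hP x, sq_nonneg (inner ℝ ν x)]
  have hPL : LipschitzWith 1 P := LipschitzWith.of_dist_le_mul fun x y => by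
    rw [NNReal.coe_one, one_mul, dist_eq_norm, dist_eq_norm, ← map_sub]
    exact hP1 _
  -- Two zeros differ by a vector nearly orthogonal to `ν`: `|⟨ν, x - y⟩| ≤ ε ‖x - y‖`. Hence `‖x -
  -- y‖ ≤ ‖P (x - y)‖ + ε ‖x - y‖`.
  have hanti : ∀ x ∈ S ∩ B, ∀ y ∈ S ∩ B,
      dist x y ≤ (Real.toNNReal (1 - ε)⁻¹ : NNReal) * dist (P x) (P y) := by
    intro x hx y hy
    have h1 := h.abs_sub_inner_le x hx.2 y hy.2
    rw [show u x = 0 from hx.1, show u y = 0 from hy.1, ← hc, hgν, inner_smul_left] at h1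
    simp only [conj_trivial, sub_zero, zero_sub, abs_neg, abs_mul, abs_of_pos hc0] at h1
    have h2 : |inner ℝ ν (x - y)| ≤ ε * ‖x - y‖ := by
      by_contra hcon
      push Not at hcon
      nlinarith
    have h3 : ‖x - y‖ ≤ ‖P (x - y)‖ + |inner ℝ ν (x - y)| := by
      refine abs_le_of_sq_le_sq' ?_ (by positivity) |>.2
      nlinarith [hP (x - y), sq_abs (inner ℝ ν (x - y)),
        mul_nonneg (norm_nonneg (P (x - y))) (abs_nonneg (inner ℝ ν (x - y)))]
    rw [Real.coe_toNNReal _ (by rw [inv_nonneg]; linarith), dist_eq_norm, dist_eq_norm, ← map_sub, inv_mul_eq_div,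
      le_div_iff₀ (by linarith)]
    linarith
  have hup : ∀ A ⊆ B, volume (P '' (S ∩ A)) ≤ μHE[n] (S ∩ A) := fun A _ => by
    rw [← EuclideanSpace.euclideanHausdorffMeasure_eq_volume]
    simpa using (hPL.lipschitzOnWith (s := S ∩ A)).euclideanHausdorffMeasure_image_le n
  have hdown : ∀ A ⊆ B, μHE[n] (S ∩ A) ≤
      ENNReal.ofReal (((1 - ε)⁻¹) ^ n) * volume (P '' (S ∩ A)) := fun A hA => by
    have h1 := euclideanHausdorffMeasure_le_of_dist_le
      (fun x hx y hy => hanti x ⟨hx.1, hA hx.2⟩ y ⟨hy.1, hA hy.2⟩) n (s := S ∩ A)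
    rw [EuclideanSpace.euclideanHausdorffMeasure_eq_volume] at h1
    rw [ENNReal.ofReal_pow (by rw [inv_nonneg]; linarith)]
    exact h1
  have hPfin : ∀ A ⊆ B, volume (P '' (S ∩ A)) < ⊤ := fun A hA =>
    (measure_mono (Set.image_mono (Set.inter_subset_right.trans hA))).trans_lt
      ((isCompact_closedBall x₀ r).image P.continuous).measure_lt_top
  have hHfin : ∀ A ⊆ B, μHE[n] (S ∩ A) < ⊤ := fun A hA =>
    (hdown A hA).trans_lt (ENNReal.mul_lt_top ENNReal.ofReal_lt_top (hPfin A hA))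
  refine ⟨r, hr, hHfin B subset_rfl, fun A hAB hA hnull => ?_⟩
  have hSA : MeasurableSet (S ∩ A) := by
    have : S ∩ A = (B ∩ S) ∩ A := by
      ext x; exact ⟨fun hx => ⟨⟨hAB hx.2, hx.1⟩, hx.2⟩, fun hx => ⟨hx.1.2, hx.2⟩⟩
    rw [this]; exact hSB.measurableSet.inter hA
  have hinj : Set.InjOn P (S ∩ A) := fun x hx y hy hxy => by
    have := hanti x ⟨hx.1, hAB hx.2⟩ y ⟨hy.1, hAB hy.2⟩
    rw [hxy, dist_self, mul_zero] at this
    exact dist_le_zero.1 this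
  have hm : MeasurableSet (P '' (S ∩ A)) :=
    hSA.image_of_continuousOn_injOn P.continuous.continuousOn hinj
  have hfA : frontier A ⊆ B :=
    frontier_subset_closure.trans (closure_minimal hAB Metric.isClosed_closedBall)
  have hPnull : volume (P '' (S ∩ frontier A)) = 0 :=
    le_antisymm ((hup _ hfA).trans hnull.le) zero_le
  obtain ⟨L, hL, hL1, hL2⟩ := h.exists_tendsto_exp_integral hg hε hε1 hν hgν he hPe hP hA hAB
    hPnull hm (hPfin A hAB).ne
  rw [← hc] at hL1 hL2
  have hVH : volume.real (P '' (S ∩ A)) ≤ μHE[n].real (S ∩ A) :=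
    ENNReal.toReal_mono (hHfin A hAB).ne (hup A hAB)
  have hHV : μHE[n].real (S ∩ A) ≤ ((1 - ε)⁻¹) ^ n * volume.real (P '' (S ∩ A)) := by
    have h0 : (0 : ℝ) ≤ ((1 - ε)⁻¹) ^ n := pow_nonneg (by rw [inv_nonneg]; linarith) _
    have := ENNReal.toReal_mono
      (ENNReal.mul_ne_top ENNReal.ofReal_ne_top (hPfin A hAB).ne) (hdown A hAB)
    rwa [ENNReal.toReal_mul, ENNReal.toReal_ofReal h0] at this
  have hgr : ∀ x ∈ S ∩ A, (1 - ε) * c ≤ ‖gradient u x‖ ∧ ‖gradient u x‖ ≤ (1 + ε) * c := by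
    intro x hx
    have h1 := h.norm_gradient_sub_le x (hAB hx.2)
    have h2 := abs_norm_sub_norm_le (gradient u x) (gradient u x₀)
    rw [← hc] at h1 h2
    have h3 := abs_le.1 (h2.trans h1)
    constructor <;> linarith
  have hm0 : 0 < (1 - ε) * c := mul_pos (by linarith) hc0
  have hM0 : 0 < (1 + ε) * c := by positivity
  have hcont : ContinuousOn (fun x => 1 / ‖gradient u x‖) (S ∩ A) := by
    refine ContinuousOn.div continuousOn_const (ContinuousOn.norm fun x hx =>
      (h.contDiffAt x (hAB hx.2)).continuousAt_gradient.continuousWithinAt) fun x hx => ?_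
    exact (hm0.trans_le (hgr x hx).1).ne'
  have hint : IntegrableOn (fun x => 1 / ‖gradient u x‖) (S ∩ A) μHE[n] := by
    refine IntegrableOn.of_bound (C := 1 / ((1 - ε) * c)) (hHfin A hAB)
      (hcont.aestronglyMeasurable hSA) ((ae_restrict_iff' hSA).2 (Eventually.of_forall
      fun x hx => ?_))
    rw [Real.norm_of_nonneg (by positivity)]
    exact one_div_le_one_div_of_le hm0 (hgr x hx).1
  have hconst : ∀ k : ℝ, IntegrableOn (fun _ => k) (S ∩ A) μHE[n] := fun k =>
    integrableOn_const (hHfin A hAB).ne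
  have hΦ1 : μHE[n].real (S ∩ A) * (1 / ((1 + ε) * c)) ≤
      ∫ x in S ∩ A, 1 / ‖gradient u x‖ ∂μHE[n] := by
    rw [← smul_eq_mul, ← setIntegral_const]
    exact setIntegral_mono_on (hconst _) hint hSA fun x hx =>
      one_div_le_one_div_of_le (hm0.trans_le (hgr x hx).1) (hgr x hx).2
  have hΦ2 : ∫ x in S ∩ A, 1 / ‖gradient u x‖ ∂μHE[n] ≤
      μHE[n].real (S ∩ A) * (1 / ((1 - ε) * c)) := by
    rw [← smul_eq_mul, ← setIntegral_const]
    exact setIntegral_mono_on hint (hconst _) hSA fun x hx =>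
      one_div_le_one_div_of_le hm0 (hgr x hx).1
  have hq : (1 : ℝ) ≤ (1 - ε)⁻¹ := (one_le_inv₀ (by linarith)).2 (by linarith)
  have hd : 0 < 1 - ε := by linarith
  have hratio : 1 / ((1 - ε) * c) = (1 + ε) / (1 - ε) * (1 / ((1 + ε) * c)) := by
    field_simp
  have hk : 0 ≤ (1 + ε) / (1 - ε) := by positivity
  refine ⟨⟨hint, L, hL, ?_, ?_⟩, hSA⟩
  · have hΦ0 : 0 ≤ ∫ x in S ∩ A, 1 / ‖gradient u x‖ ∂μHE[n] :=
      integral_nonneg fun x => by positivity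
    calc L ≤ volume.real (P '' (S ∩ A)) * (1 / ((1 - ε) * c)) := hL2
      _ ≤ μHE[n].real (S ∩ A) * (1 / ((1 - ε) * c)) := by gcongr
      _ = (1 + ε) / (1 - ε) * (μHE[n].real (S ∩ A) * (1 / ((1 + ε) * c))) := by
        rw [hratio]; ring
      _ ≤ (1 + ε) / (1 - ε) * ∫ x in S ∩ A, 1 / ‖gradient u x‖ ∂μHE[n] := by gcongr
      _ ≤ K * ∫ x in S ∩ A, 1 / ‖gradient u x‖ ∂μHE[n] := by
        refine mul_le_mul_of_nonneg_right (le_trans ?_ hεK.le) hΦ0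
        exact le_mul_of_one_le_right hk (one_le_pow₀ hq)
  · have hV0 : 0 ≤ volume.real (P '' (S ∩ A)) * (1 / ((1 + ε) * c)) := by positivity
    calc _ ≤ μHE[n].real (S ∩ A) * (1 / ((1 - ε) * c)) := hΦ2
      _ ≤ ((1 - ε)⁻¹ ^ n * volume.real (P '' (S ∩ A))) * (1 / ((1 - ε) * c)) := by gcongr
      _ = (1 + ε) / (1 - ε) * (1 - ε)⁻¹ ^ n *
          (volume.real (P '' (S ∩ A)) * (1 / ((1 + ε) * c))) := by rw [hratio]; ring
      _ ≤ K * (volume.real (P '' (S ∩ A)) * (1 / ((1 + ε) * c))) := by gcongr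
      _ ≤ K * L := by gcongr

/-! ### Gluing the pieces by compactness. -/

/-- Both comparisons are linear in the limit and the integral, so `K` does not deteriorate with the
number of pieces. -/
theorem HasApproxLimit.union {u : EuclideanSpace ℝ (Fin (n + 1)) → ℝ} {K : ℝ}
    {A B : Set (EuclideanSpace ℝ (Fin (n + 1)))} (hA : HasApproxLimit u K A)
    (hB : HasApproxLimit u K B) (hAB : Disjoint A B) (hBm : MeasurableSet B)
    (hSB : MeasurableSet ({x | u x = 0} ∩ B))
    (hint : ∀ α : ℝ, IntegrableOn (fun x => Real.exp (-α * |u x|)) (A ∪ B)) :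
    HasApproxLimit u K (A ∪ B) := by
  obtain ⟨hA0, L, hL, hL1, hL2⟩ := hA
  obtain ⟨hB0, M, hM, hM1, hM2⟩ := hB
  have hd : Disjoint ({x | u x = 0} ∩ A) ({x | u x = 0} ∩ B) :=
    hAB.mono Set.inter_subset_right Set.inter_subset_right
  rw [HasApproxLimit, Set.inter_union_distrib_left, setIntegral_union hd hSB hA0 hB0]
  refine ⟨hA0.union hB0, L + M, (hL.add hM).congr' ?_, by linarith, by linarith⟩
  refine Eventually.of_forall fun α => ?_
  simp only
  rw [setIntegral_union hAB hBm ((hint α).mono_set Set.subset_union_left)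
    ((hint α).mono_set Set.subset_union_right)]
  ring

theorem measure_inter_frontier_union_eq_zero {X : Type*} [TopologicalSpace X] [MeasurableSpace X]
    {μ : Measure X} {S A B : Set X} (hA : μ (S ∩ frontier A) = 0) (hB : μ (S ∩ frontier B) = 0) :
    μ (S ∩ frontier (A ∪ B)) = 0 := by
  refine measure_mono_null ?_ (measure_union_null hA hB)
  rintro x ⟨hx, hx'⟩
  rcases frontier_union_subset A B hx' with h | h
  · exact Or.inl ⟨hx, h.1⟩
  · exact Or.inr ⟨hx, h.2⟩

theorem measure_inter_frontier_inter_eq_zero {X : Type*} [TopologicalSpace X] [MeasurableSpace X]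
    {μ : Measure X} {S A B : Set X} (hA : μ (S ∩ frontier A) = 0) (hB : μ (S ∩ frontier B) = 0) :
    μ (S ∩ frontier (A ∩ B)) = 0 := by
  refine measure_mono_null ?_ (measure_union_null hA hB)
  rintro x ⟨hx, hx'⟩
  rcases frontier_inter_subset A B hx' with h | h
  · exact Or.inl ⟨hx, h.1⟩
  · exact Or.inr ⟨hx, h.2⟩

section
variable {u : EuclideanSpace ℝ (Fin (n + 1)) → ℝ} {Ω : Set (EuclideanSpace ℝ (Fin (n + 1)))}

theorem integrableOn_exp_neg_mul_abs (hb : Bornology.IsBounded Ω)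
    (hc : ContinuousOn u (closure Ω)) (α : ℝ) :
    IntegrableOn (fun x => Real.exp (-α * |u x|)) Ω := by
  have h : ContinuousOn (fun x => Real.exp (-α * |u x|)) (closure Ω) :=
    Real.continuous_exp.comp_continuousOn (hc.abs.const_mul _)
  exact (h.integrableOn_compact hb.isCompact_closure).mono_set subset_closure

theorem isCompact_zeroSet_inter_closure (hb : Bornology.IsBounded Ω)
    (hc : ContinuousOn u (closure Ω)) : IsCompact ({x | u x = 0} ∩ closure Ω) := by
  rw [Set.inter_comm]
  exact hb.isCompact_closure.of_isClosed_subset (hc.preimage_isClosed_of_isClosed isClosed_closure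
    (isClosed_singleton (x := (0 : ℝ)))) Set.inter_subset_left

theorem measurableSet_zeroSet_inter (hm : MeasurableSet Ω) (hb : Bornology.IsBounded Ω)
    (hc : ContinuousOn u (closure Ω)) : MeasurableSet ({x | u x = 0} ∩ Ω) := by
  have h := (isCompact_zeroSet_inter_closure hb hc).measurableSet.inter hm
  rwa [Set.inter_assoc, Set.inter_eq_right.2 (subset_closure (s := Ω))] at h

/-- Induction on compact sets. The property speaks of every admissible `A ⊆ U`, so that for a union
`U ∪ V` a piece splits into the disjoint parts `A ∩ U` and `A \ U`. -/
theorem exists_open_superset_hasApproxLimit (hb : Bornology.IsBounded Ω)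
    (hc : ContinuousOn u (closure Ω))
    (hs : ∀ x ∈ {x | u x = 0} ∩ closure Ω, ContDiffAt ℝ 1 u x)
    (hr : ∀ x ∈ {x | u x = 0} ∩ closure Ω, gradient u x ≠ 0) {K : ℝ} (hK : 1 < K) :
    ∃ U, {x | u x = 0} ∩ closure Ω ⊆ U ∧ IsOpen U ∧ μHE[n] ({x | u x = 0} ∩ frontier U) = 0 ∧
      ∀ A ⊆ U, A ⊆ Ω → MeasurableSet A → μHE[n] ({x | u x = 0} ∩ frontier A) = 0 →
        HasApproxLimit u K A ∧ MeasurableSet ({x | u x = 0} ∩ A) := by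
  refine (isCompact_zeroSet_inter_closure hb hc).induction_on
    (p := fun s => ∃ U, s ⊆ U ∧ IsOpen U ∧ μHE[n] ({x | u x = 0} ∩ frontier U) = 0 ∧
      ∀ A ⊆ U, A ⊆ Ω → MeasurableSet A → μHE[n] ({x | u x = 0} ∩ frontier A) = 0 →
        HasApproxLimit u K A ∧ MeasurableSet ({x | u x = 0} ∩ A)) ?_ ?_ ?_ ?_
  · refine ⟨∅, subset_rfl, isOpen_empty, by simp, fun A hA _ _ _ => ?_⟩
    rw [Set.subset_empty_iff.1 hA, HasApproxLimit]
    simp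
  · rintro s t hst ⟨U, hU, h⟩
    exact ⟨U, hst.trans hU, h⟩
  · rintro s t ⟨U, hsU, hU, hU0, h⟩ ⟨V, htV, hV, hV0, h'⟩
    refine ⟨U ∪ V, Set.union_subset_union hsU htV, hU.union hV,
      measure_inter_frontier_union_eq_zero hU0 hV0, fun A hA hAΩ hAm hA0 => ?_⟩
    obtain ⟨h1, h2⟩ := h (A ∩ U) Set.inter_subset_right (Set.inter_subset_left.trans hAΩ)
      (hAm.inter hU.measurableSet) (measure_inter_frontier_inter_eq_zero hA0 hU0)
    obtain ⟨h3, h4⟩ := h' (A \ U) (fun x hx => (hA hx.1).resolve_left hx.2)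
      (Set.sdiff_subset.trans hAΩ) (hAm.diff hU.measurableSet)
      (measure_inter_frontier_inter_eq_zero hA0 (B := Uᶜ) (by rwa [frontier_compl]))
    have heq : A ∩ U ∪ A \ U = A := Set.inter_union_sdiff A U
    rw [← heq]
    refine ⟨h1.union h3 Set.disjoint_sdiff_inter.symm (hAm.diff hU.measurableSet) h4
      fun α => ?_, ?_⟩
    · rw [heq]
      exact (integrableOn_exp_neg_mul_abs hb hc α).mono_set hAΩ
    · rw [Set.inter_union_distrib_left]
      exact h2.union h4
  · intro x hx
    obtain ⟨r, hr0, hfin, h⟩ := exists_closedBall_hasApproxLimit (hs x hx) (hr x hx) hK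
    -- Surface measure restricted to the ball is finite, so some sphere of radius below `r` is null
    -- for it; this makes the frontier of the chosen ball negligible.
    have : IsFiniteMeasure ((μHE[n] : Measure (EuclideanSpace ℝ (Fin (n + 1)))).restrict
        ({x | u x = 0} ∩ Metric.closedBall x r)) := ⟨by simpa using hfin⟩
    obtain ⟨ρ, hρ, hρ0⟩ := exists_null_frontier_thickening
      ((μHE[n] : Measure (EuclideanSpace ℝ (Fin (n + 1)))).restrict
        ({x | u x = 0} ∩ Metric.closedBall x r)) {x} hr0
    rw [Metric.thickening_singleton, Measure.restrict_apply isClosed_frontier.measurableSet] at hρ0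
    refine ⟨Metric.ball x ρ, mem_nhdsWithin_of_mem_nhds (Metric.ball_mem_nhds x hρ.1),
      Metric.ball x ρ, subset_rfl, Metric.isOpen_ball, ?_, fun A hA _ hAm hA0 => ?_⟩
    · refine measure_mono_null (fun y hy => (⟨hy.2, hy.1, ?_⟩ : _ ∧ _ ∧ _)) hρ0
      exact Metric.closedBall_subset_closedBall hρ.2.le
        (Metric.closure_ball_subset_closedBall (frontier_subset_closure hy.2))
    · exact h A (hA.trans (Metric.ball_subset_closedBall.trans
        (Metric.closedBall_subset_closedBall hρ.2.le))) hAm hA0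

theorem hasApproxLimit_of_regular (hm : MeasurableSet Ω) (hb : Bornology.IsBounded Ω)
    (hc : ContinuousOn u (closure Ω))
    (hs : ∀ x ∈ {x | u x = 0} ∩ closure Ω, ContDiffAt ℝ 1 u x)
    (hr : ∀ x ∈ {x | u x = 0} ∩ closure Ω, gradient u x ≠ 0)
    (h0 : μHE[n] ({x | u x = 0} ∩ frontier Ω) = 0) {K : ℝ} (hK : 1 < K) :
    HasApproxLimit u K Ω := by
  obtain ⟨U, hSU, hU, hU0, h⟩ := exists_open_superset_hasApproxLimit hb hc hs hr hK
  obtain ⟨h1, -⟩ := h (Ω ∩ U) Set.inter_subset_right Set.inter_subset_left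
    (hm.inter hU.measurableSet) (measure_inter_frontier_inter_eq_zero h0 hU0)
  have hempty : {x | u x = 0} ∩ (Ω \ U) = ∅ := Set.eq_empty_of_forall_notMem
    fun x hx => hx.2.2 (hSU ⟨hx.1, subset_closure hx.2.1⟩)
  -- `U` contains every zero in `closure Ω`, so `|u|` is bounded below on the compact set `closure Ω
  -- \ U`.
  have h2 : HasApproxLimit u K (Ω \ U) := by
    obtain ⟨δ, hδ, hδ'⟩ := (hb.isCompact_closure.diff hU).exists_forall_le' (a := 0)
      (f := fun x => |u x|) (hc.mono Set.sdiff_subset).abs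
      (fun x hx => abs_pos.2 fun hx0 => hx.2 (hSU ⟨hx0, hx.1⟩))
    rw [HasApproxLimit, hempty]
    refine ⟨integrableOn_empty, 0, tendsto_exp_integral_zero ?_ hδ fun x hx =>
      hδ' x ⟨subset_closure hx.1, hx.2⟩, by simp, by simp⟩
    exact ((measure_mono Set.sdiff_subset).trans_lt hb.measure_lt_top).ne
  have heq : Ω ∩ U ∪ Ω \ U = Ω := Set.inter_union_sdiff Ω U
  rw [← heq]
  refine h1.union h2 Set.disjoint_sdiff_inter.symm (hm.diff hU.measurableSet)
    (by rw [hempty]; exact MeasurableSet.empty) fun α => ?_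
  rw [heq]
  exact integrableOn_exp_neg_mul_abs hb hc α

/-! ### Removal of the factor `K`. -/

theorem Real.le_of_forall_one_lt_le_mul {a b : ℝ} (h : ∀ K : ℝ, 1 < K → a ≤ K * b) : a ≤ b := by
  have h1 : Tendsto (fun K : ℝ => K * b) (𝓝[>] 1) (𝓝 (1 * b)) :=
    ((continuous_id.mul continuous_const).tendsto (1 : ℝ)).mono_left nhdsWithin_le_nhds
  rw [one_mul] at h1
  exact ge_of_tendsto h1 (by filter_upwards [self_mem_nhdsWithin] with K hK using h K hK)

theorem tendsto_exp_integral_level_set (hm : MeasurableSet Ω) (hb : Bornology.IsBounded Ω)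
    (hc : ContinuousOn u (closure Ω))
    (hs : ∀ x ∈ {x | u x = 0} ∩ closure Ω, ContDiffAt ℝ 1 u x)
    (hr : ∀ x ∈ {x | u x = 0} ∩ closure Ω, gradient u x ≠ 0)
    (h0 : μHE[n] ({x | u x = 0} ∩ frontier Ω) = 0) :
    IntegrableOn (fun x => 1 / ‖gradient u x‖) ({x | u x = 0} ∩ Ω) μHE[n] ∧
    Tendsto (fun α : ℝ => α / 2 * ∫ x in Ω, Real.exp (-α * |u x|)) atTop
      (𝓝 (∫ x in {x | u x = 0} ∩ Ω, 1 / ‖gradient u x‖ ∂μHE[n])) := by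
  have h := fun (K : ℝ) (hK : 1 < K) => hasApproxLimit_of_regular hm hb hc hs hr h0 hK
  obtain ⟨hi, L, hL, -⟩ := h 2 one_lt_two
  refine ⟨hi, ?_⟩
  -- By uniqueness of limits the same `L` serves every `K`.
  have hK : ∀ K : ℝ, 1 < K → L ≤ K * ∫ x in {x | u x = 0} ∩ Ω, 1 / ‖gradient u x‖ ∂μHE[n] ∧
      ∫ x in {x | u x = 0} ∩ Ω, 1 / ‖gradient u x‖ ∂μHE[n] ≤ K * L := fun K hK => by
    obtain ⟨-, M, hM, hM'⟩ := h K hK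
    rwa [tendsto_nhds_unique hL hM]
  rwa [← le_antisymm (Real.le_of_forall_one_lt_le_mul fun K h => (hK K h).1)
    (Real.le_of_forall_one_lt_le_mul fun K h => (hK K h).2)]
end

/-! ### Signed distance fields and the final statement. -/

/-- At a regular zero, a signed distance field has a unit gradient. -/
theorem IsSignedDistanceField.norm_gradient_eq_one {u : EuclideanSpace ℝ (Fin n) → ℝ}
    (h : IsSignedDistanceField u) {x : EuclideanSpace ℝ (Fin n)} (hx : u x = 0)
    (hu : ContDiffAt ℝ 1 u x) (hg : gradient u x ≠ 0) : ‖gradient u x‖ = 1 := by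
  set g := gradient u x with hgdef
  have hg0 : 0 < ‖g‖ := norm_pos_iff.2 hg
  have hclosed : IsClosed {y | u y = 0} := isClosed_eq h.1 continuous_const
  -- Move from `x` to `y = x + t • g`. The field grows to at least `(1 - ε) ‖g‖ · t ‖g‖`, while the
  -- distance of `y` to the zero set is at most `t ‖g‖`. Conversely, from a nearest zero `p` the
  -- field grows to `‖y - p‖`, at rate at most `(1 + ε) ‖g‖`.
  have key : ∀ ε : ℝ, 0 < ε → ε < 1 → (1 - ε) * ‖g‖ ≤ 1 ∧ 1 ≤ (1 + ε) * ‖g‖ := by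
    intro ε hε hε1
    obtain ⟨r, hr, hn⟩ := hu.exists_nearlyAffineOn hg hε
    -- The bound `r / 2` keeps `p` in the ball: its distance from `x` is at most `2 t ‖g‖`.
    obtain ⟨t, ht, htr⟩ : ∃ t : ℝ, 0 < t ∧ t * ‖g‖ ≤ r / 2 :=
      ⟨r / 2 / ‖g‖, by positivity, by rw [div_mul_cancel₀ _ hg0.ne']⟩
    set y := x + t • g with hy
    have hyx : ‖y - x‖ = t * ‖g‖ := by
      rw [hy, add_sub_cancel_left, norm_smul, Real.norm_of_nonneg ht.le]
    have hxB : x ∈ Metric.closedBall x r := Metric.mem_closedBall_self hr.le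
    have hyB : y ∈ Metric.closedBall x r := by
      rw [Metric.mem_closedBall, dist_eq_norm, hyx]; linarith
    have hlow : (1 - ε) * ‖g‖ * (t * ‖g‖) ≤ |u y| := by
      have h1 := hn.abs_sub_inner_le y hyB x hxB
      rw [hx, hyx, hy, add_sub_cancel_left, inner_smul_right, ← hgdef,
        real_inner_self_eq_norm_sq] at h1
      have h2 := (abs_le.1 h1).1
      rw [sub_zero] at h2
      refine le_trans ?_ (le_abs_self _)
      nlinarith
    have hdist : |u y| ≤ t * ‖g‖ := by
      rw [h.2 y, ← hyx, ← dist_eq_norm]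
      exact Metric.infDist_le_dist_of_mem hx
    have htg : 0 < t * ‖g‖ := by positivity
    refine ⟨by nlinarith, ?_⟩
    obtain ⟨p, hp, hpd⟩ := hclosed.exists_infDist_eq_dist ⟨x, hx⟩ y
    have hup : |u y| = ‖y - p‖ := by rw [h.2 y, hpd, dist_eq_norm]
    have hpB : p ∈ Metric.closedBall x r := by
      rw [Metric.mem_closedBall, dist_eq_norm]
      have : p - x = (y - x) - (y - p) := by abel
      rw [this]
      refine (norm_sub_le _ _).trans ?_
      rw [← hup, hyx]; linarith
    have h1 := hn.abs_sub_inner_le y hyB p hpB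
    rw [show u p = 0 from hp, sub_zero, ← hgdef] at h1
    have h2 := abs_real_inner_le_norm g (y - p)
    have h3 := abs_sub_abs_le_abs_sub (u y) (inner ℝ g (y - p))
    have hpos : 0 < ‖y - p‖ := by
      rw [← hup]
      exact lt_of_lt_of_le (by have : 0 < 1 - ε := by linarith
                               positivity) hlow
    nlinarith
  refine le_antisymm ?_ ?_
  · by_contra hcon
    push Not at hcon
    have h1 : 0 < 1 - 1 / ‖g‖ := by rw [sub_pos, div_lt_one hg0]; exact hcon
    -- With this `ε`, `(1 - ε) ‖g‖ = (‖g‖ + 1) / 2`, which exceeds 1.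
    have h2 := (key ((1 - 1 / ‖g‖) / 2) (by positivity) (by
      have : 0 < 1 / ‖g‖ := by positivity
      linarith)).1
    have h3 : 1 / ‖g‖ * ‖g‖ = 1 := by field_simp
    nlinarith
  · refine Real.le_of_forall_one_lt_le_mul fun K hK => ?_
    have h1 : 0 < min (K - 1) (1 / 2) := lt_min (by linarith) (by norm_num)
    refine (key _ h1 ((min_le_right _ _).trans_lt (by norm_num))).2.trans ?_
    have := min_le_left (K - 1) (1 / 2)
    gcongr
    linarith

end

theorem theorem1 {Θ : Type*} (n : ℕ)
    (f : Θ → EuclideanSpace ℝ (Fin (n + 1)) → ℝ) (θ : Θ)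
    (Ω : Set (EuclideanSpace ℝ (Fin (n + 1))))
    (hΩ_meas : MeasurableSet Ω) (hΩ_bdd : Bornology.IsBounded Ω)
    (hf_cont : ContinuousOn (f θ) (closure Ω))
    (hf_smooth : ∀ x ∈ zeroLevelSet f θ ∩ closure Ω, ContDiffAt ℝ 1 (f θ) x)
    (hf_reg : ∀ x ∈ zeroLevelSet f θ ∩ closure Ω, gradient (f θ) x ≠ 0)
    (hbdry : μHE[n] (zeroLevelSet f θ ∩ frontier Ω) = 0) :
    ((∀ α : ℝ, 0 < α → IntegrableOn (fun x => Real.exp (-α * |f θ x|)) Ω) ∧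
      IntegrableOn (fun x => 1 / ‖gradient (f θ) x‖) (zeroLevelSet f θ ∩ Ω) μHE[n] ∧
      Tendsto (fun α : ℝ => ssaLoss Ω f α θ) atTop
        (𝓝 (∫ x in zeroLevelSet f θ ∩ Ω, 1 / ‖gradient (f θ) x‖ ∂μHE[n]))) ∧
    (IsSignedDistanceField (f θ) ∨ SatisfiesEikonalOn (f θ) (zeroLevelSet f θ ∩ Ω) →
      μHE[n] (zeroLevelSet f θ ∩ Ω) < ⊤ ∧
      Tendsto (fun α : ℝ => ssaLoss Ω f α θ) atTop
        (𝓝 (μHE[n] (zeroLevelSet f θ ∩ Ω)).toReal)) := by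
  obtain ⟨hi, hL⟩ := tendsto_exp_integral_level_set hΩ_meas hΩ_bdd hf_cont hf_smooth hf_reg hbdry
  refine ⟨⟨fun α _ => integrableOn_exp_neg_mul_abs hΩ_bdd hf_cont α, hi, hL⟩, fun h => ?_⟩
  -- Either alternative makes the integrand 1 on the surface, so its integrability gives finite
  -- area.
  have hone : SatisfiesEikonalOn (f θ) (zeroLevelSet f θ ∩ Ω) := by
    refine h.elim (fun h x hx => ?_) id
    have hx' : x ∈ zeroLevelSet f θ ∩ closure Ω := ⟨hx.1, subset_closure hx.2⟩
    exact h.norm_gradient_eq_one hx.1 (hf_smooth x hx') (hf_reg x hx')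
  have hm : MeasurableSet (zeroLevelSet f θ ∩ Ω) :=
    measurableSet_zeroSet_inter hΩ_meas hΩ_bdd hf_cont
  have heq : Set.EqOn (fun x => 1 / ‖gradient (f θ) x‖) (fun _ => 1) (zeroLevelSet f θ ∩ Ω) :=
    fun x hx => by simp [hone x hx]
  have hfin : μHE[n] (zeroLevelSet f θ ∩ Ω) < ⊤ := by
    have h1 : IntegrableOn (fun _ => (1 : ℝ)) (zeroLevelSet f θ ∩ Ω) μHE[n] :=
      hi.congr_fun heq hm
    exact (integrableOn_const_iff (by simp)).1 h1 |>.resolve_left (by simp)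
  refine ⟨hfin, ?_⟩
  have h2 : ∫ x in zeroLevelSet f θ ∩ Ω, 1 / ‖gradient (f θ) x‖ ∂μHE[n] =
      (μHE[n] (zeroLevelSet f θ ∩ Ω)).toReal := by
    rw [setIntegral_congr_fun hm heq]
    simp [Measure.real]
  rw [← h2]
  exact hL
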